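/- Let $Q=[a_1,b_1]\times\dots\times[a_d,b_d]\subset\mathbb R^d$ with $a_i<b_i$ for all $i$, equipped with Lebesgue measure, and let $\sigma\in\{-1,0,1\}^d$. Write $x\le_\sigma y$ iff $\sigma_ix_i\le\sigma_iy_i$ for all $i$ with $\sigma_i\neq0$ and $x_i=y_i$ for all $i$ with $\sigma_i=0$. For $I\subset\mathbb R$ let $L^2_\sigma(Q,I)$ be the set of all $g\in L^2(Q,\mathbb R)$ with $g(x)\in I$ for a.e. $x\in Q$ such that, for some null set $N$, $g(x)\le g(y)$ for all $x,y\in Q\setminus N$ with $x\le_\sigma y$. A function on $Q$ is dyadically grid-constant if, for some $n\in\mathbb N$, it is constant on all cells $I_1\times\dots\times I_d$, where each $I_i$ is one of the $2^n$ intervals of equal length into which $[a_i,b_i]$ is divided (closed on the left and open on the right, except that the last one is closed). For $J\subset\mathbb R$ let $S(Q,J)$ be the set of such functions with values in $J$, and let $S^\infty(Q,(0,\infty)):=\bigcup_{c>0}\overline{S(Q,[c,\infty))}^{\|\cdot\|_\infty}\subset L^\infty(Q,\mathbb R)$. Let $f\in L^2(Q,\mathbb R)$, $w\in S^\infty(Q,(0,\infty))$,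 and let $f^*:=p^w_\sigma(f)$ be the $\sigma$-monotonic regression of $f$, that is, the (unique) minimizer of $g\mapsto\int_Q|f(x)-g(x)|^2w(x)\,dx$ over $g\in L^2_\sigma(Q,\mathbb R)$. Let $\Phi:I\to\mathbb R$ be a convex function on an interval $I\subset\mathbb R$ and let $\phi:I\to\mathbb R\cup\{\pm\infty\}$ satisfy $\Phi'_-(u)\le\phi(u)\le\Phi'_+(u)$ for all $u\in I$. Here $\Phi'_\pm$ are the one-sided derivatives in $[-\infty,\infty]$ of $\Phi$, extended by $+\infty$ outside $I$; thus $\Phi'_-(\min I)=-\infty$ and $\Phi'_+(\max I)=+\infty$ whenever $\min I$ or $\max I$ exists. Suppose that $f_0(Q)\subset I$ for some representative $f_0$ of $f$, and that $$\Phi\circ f\in L^1(Q,\mathbb R),\qquad \Phi\circ g\in L^1(Q,\mathbb R)\qquad\text{and}\qquad\phi\circ g\in L^2(Q,\mathbb R)\qquad\text{for all }g\in L^2_\sigma(Q,I).$$ Put $\Delta_\Phi(u,v):=\Phi(u)-\Phi(v)-\phi(v)(u-v)$ for $u,v\in I$; here $\phi$ is finite on $I$, because the constant functions with values in $I$ belong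 to $L^2_\sigma(Q,I)$. Then the functional $$J^\Phi_{f,w}(g):=\int_Q\Delta_\Phi(f(x),g(x))\,w(x)\,dx\qquad(g\in L^2_\sigma(Q,I))$$ is well-defined (its integrand is integrable for every $g\in L^2_\sigma(Q,I)$), and $f^*$ belongs to $L^2_\sigma(Q,I)$ and minimizes $J^\Phi_{f,w}$ over $L^2_\sigma(Q,I)$. If $\Phi$ is strictly convex, then $f^*$ is the only minimizer of $J^\Phi_{f,w}$ over $L^2_\sigma(Q,I)$. -/

import Mathlib

open MeasureTheory Filter Topology
open scoped ENNReal

noncomputable section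

namespace MonotonicRegression

/-- Lebesgue measure on the rectangle `Q = [a₁,b₁] × ⋯ × [a_d,b_d]`. -/
abbrev boxMeasure {d : ℕ} (a b : Fin d → ℝ) : Measure (Fin d → ℝ) :=
  volume.restrict (Set.Icc a b)

/-- The partial order `≤_σ` on `ℝ^d` belonging to a signature `σ ∈ {-1,0,1}^d`. -/
def SigLE {d : ℕ} (σ : Fin d → SignType) (x y : Fin d → ℝ) : Prop :=
  (∀ i, σ i ≠ 0 → (σ i : ℝ) * x i ≤ (σ i : ℝ) * y i) ∧ ∀ i, σ i = 0 → x i = y i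

/-- `f` is `σ`-monotonic on the set `X`, i.e. isotonic with respect to `≤_σ` restricted to `X`. -/
def SigMonotoneOn {d : ℕ} (σ : Fin d → SignType) (f : (Fin d → ℝ) → ℝ)
    (X : Set (Fin d → ℝ)) : Prop :=
  ∀ x ∈ X, ∀ y ∈ X, SigLE σ x y → f x ≤ f y

/-- `f` is essentially `σ`-monotonic on `Q`: it is `σ`-monotonic after removal of a null set. -/
def EssSigMonotone {d : ℕ} (a b : Fin d → ℝ) (σ : Fin d → SignType)
    (f : (Fin d → ℝ) → ℝ) : Prop :=
  ∃ N : Set (Fin d → ℝ), boxMeasure a b N = 0 ∧ SigMonotoneOn σ f (Set.Icc a b \ N)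

/-- `L²_σ(Q, I)`: the essentially `σ`-monotonic elements of `L²(Q, ℝ)` with values in `I`. -/
def L2Sig {d : ℕ} (a b : Fin d → ℝ) (σ : Fin d → SignType) (I : Set ℝ) :
    Set (Lp ℝ 2 (boxMeasure a b)) :=
  {g | EssSigMonotone a b σ g ∧ ∀ᵐ x ∂boxMeasure a b, g x ∈ I}

/-- The partition point `a i + k (b i - a i) / 2^n` of the interval `[a i, b i]`. -/
def dyadicPoint {d : ℕ} (a b : Fin d → ℝ) (n : ℕ) (i : Fin d) (k : ℕ) : ℝ :=
  a i + k * ((b i - a i) / 2 ^ n)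

/-- The cells of the dyadic grid of level `n` on `Q`: products of half-open partition intervals,
the last interval in each coordinate direction being closed. -/
def dyadicCell {d : ℕ} (a b : Fin d → ℝ) (n : ℕ) (k : Fin d → Fin (2 ^ n)) :
    Set (Fin d → ℝ) :=
  Set.univ.pi fun i =>
    if (k i : ℕ) + 1 = 2 ^ n then
      Set.Icc (dyadicPoint a b n i (k i)) (dyadicPoint a b n i (k i + 1))
    else
      Set.Ico (dyadicPoint a b n i (k i)) (dyadicPoint a b n i (k i + 1))

/-- `s` is constant on all cells of some dyadic grid on `Q`. -/
def DyadicGridConstant {d : ℕ} (a b : Fin d → ℝ) (s : (Fin d → ℝ) → ℝ) : Prop :=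
  ∃ n : ℕ, ∀ k : Fin d → Fin (2 ^ n), ∀ x ∈ dyadicCell a b n k, ∀ y ∈ dyadicCell a b n k,
    s x = s y

/-- `S(Q, J)` as a set of elements of `L^∞(Q, ℝ)`: the classes of dyadically grid-constant
functions on `Q` with values in `J`. -/
def dyadicStep {d : ℕ} (a b : Fin d → ℝ) (J : Set ℝ) : Set (Lp ℝ ∞ (boxMeasure a b)) :=
  {h | ∃ s : (Fin d → ℝ) → ℝ, DyadicGridConstant a b s ∧ (∀ x ∈ Set.Icc a b, s x ∈ J) ∧
    h =ᵐ[boxMeasure a b] s}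

/-- `S^∞(Q, (0,∞))`: the union over `c > 0` of the closures of `S(Q, [c,∞))` with respect to the
(essential) supremum norm. -/
def posWeights {d : ℕ} (a b : Fin d → ℝ) : Set (Lp ℝ ∞ (boxMeasure a b)) :=
  ⋃ c ∈ Set.Ioi (0 : ℝ), closure (dyadicStep a b (Set.Ici c))

/-- The weighted squared distance `∫_Q |f - g|² w`. -/
def sqDist {d : ℕ} {a b : Fin d → ℝ} (w : Lp ℝ ∞ (boxMeasure a b))
    (f g : Lp ℝ 2 (boxMeasure a b)) : ℝ :=
  ∫ x, |f x - g x| ^ 2 * w x ∂boxMeasure a b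

/-- `p` is a closest point to `f` in `L²_σ(Q, ℝ)` with respect to the `w`-weighted `2`-norm. -/
def IsRegression {d : ℕ} {a b : Fin d → ℝ} (σ : Fin d → SignType) (w : Lp ℝ ∞ (boxMeasure a b))
    (f p : Lp ℝ 2 (boxMeasure a b)) : Prop :=
  p ∈ L2Sig a b σ Set.univ ∧ IsMinOn (sqDist w f) (L2Sig a b σ Set.univ) p

/-- The `σ`-monotonic regression `p_σ^w(f)`: the closest point to `f` in `L²_σ(Q, ℝ)` with respect
to the `w`-weighted `2`-norm. It exists and is unique whenever `w` is bounded below by a positive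
constant, because `L²_σ(Q, ℝ)` is a nonempty closed convex subset of a Hilbert space. -/
def regression {d : ℕ} {a b : Fin d → ℝ} (σ : Fin d → SignType) (w : Lp ℝ ∞ (boxMeasure a b))
    (f : Lp ℝ 2 (boxMeasure a b)) : Lp ℝ 2 (boxMeasure a b) :=
  Classical.epsilon (IsRegression σ w f)

open Classical in
/-- The extension of `Φ : I → ℝ` to `ℝ` by the value `+∞` outside `I`. -/
def extendTop (I : Set ℝ) (Φ : ℝ → ℝ) (u : ℝ) : EReal :=
  if u ∈ I then (Φ u : EReal) else ⊤

/-- The difference quotient of the extension of `Φ : I → ℝ`, at a point `u ∈ I`. -/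
def diffQuot (I : Set ℝ) (Φ : ℝ → ℝ) (u z : ℝ) : EReal :=
  (extendTop I Φ z - extendTop I Φ u) / ((z - u : ℝ) : EReal)

/-- The left derivative `Φ'_-(u) ∈ [-∞, ∞]` of `Φ : I → ℝ` (equal to `-∞` if `u = min I`). -/
def leftDerivative (I : Set ℝ) (Φ : ℝ → ℝ) (u : ℝ) : EReal :=
  limUnder (𝓝[<] u) (diffQuot I Φ u)

/-- The right derivative `Φ'_+(u) ∈ [-∞, ∞]` of `Φ : I → ℝ` (equal to `+∞` if `u = max I`). -/
def rightDerivative (I : Set ℝ) (Φ : ℝ → ℝ) (u : ℝ) : EReal :=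
  limUnder (𝓝[>] u) (diffQuot I Φ u)

/-- An extended-real-valued function on `Q` belongs to `L²(Q, ℝ)`: it is finite almost everywhere
and its real part is square-integrable. -/
def ExtMemL2 {d : ℕ} (a b : Fin d → ℝ) (h : (Fin d → ℝ) → EReal) : Prop :=
  (∀ᵐ x ∂boxMeasure a b, h x ≠ ⊥ ∧ h x ≠ ⊤) ∧
    MemLp (fun x => (h x).toReal) 2 (boxMeasure a b)

/-- `Δ_Φ(u, v) = Φ(u) - Φ(v) - φ(v) (u - v)`, for `v` with `φ(v)` finite. -/
def bregman (Φ : ℝ → ℝ) (φ : ℝ → EReal) (u v : ℝ) : ℝ :=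
  Φ u - Φ v - (φ v).toReal * (u - v)

/-- The functional `J^Φ_{f,w}(g) = ∫_Q Δ_Φ(f(x), g(x)) w(x) dx`. -/
def bregmanFunctional {d : ℕ} {a b : Fin d → ℝ} (Φ : ℝ → ℝ) (φ : ℝ → EReal)
    (w : Lp ℝ ∞ (boxMeasure a b)) (f g : Lp ℝ 2 (boxMeasure a b)) : ℝ :=
  ∫ x, bregman Φ φ (f x) (g x) * w x ∂boxMeasure a b

end MonotonicRegression

end

/-! Let `p` be the regression and `r = (f - p) w` the weighted residual. The monotonic functions
form a convex cone, so the first-order condition at the minimizer reads `∫ h r ≤ 0` for every `h` in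
the cone. If `ψ` is 1-Lipschitz and `0 < t ≤ 1`, both `u + t ψ(u)` and `u - t ψ(u)` are increasing,
so `p ± t ψ(p)` stays in the cone. For bounded `ψ` this gives `∫ ψ(p) r = 0`
(`integral_lipschitz_mul_residual`). Ramp functions approximate indicators, so `r` has integral zero
over every Borel fibre `p ⁻¹' A`; that is, the conditional expectation of `r` given `p` vanishes.
Two consequences follow: `p` takes values in `I` (`ae_mem_of_setIntegral_preimage_eq_zero`), and `∫
φ(p) r = 0` without any continuity or boundedness of `φ`.

The three-point identity `Δ(f,g) = Δ(p,g) + Δ(f,p) + (φ(p) - φ(g)) (f - p)` is then integrated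
against `w`. The `φ(p)` term vanishes. The `φ(g)` term contributes a nonnegative amount, because `φ`
is increasing and so `φ ∘ g` lies in the cone. This is the Pythagorean inequality
`integral_bregman_add_le`; minimality follows from `Δ ≥ 0`, uniqueness from strict positivity off
the diagonal. -/

noncomputable section

namespace MonotonicRegression

/-! ### One-sided derivatives and the Bregman divergence -/

section Convex

variable {I : Set ℝ} {Φ : ℝ → ℝ} {φ : ℝ → EReal} {u z : ℝ}

theorem diffQuot_of_mem (hu : u ∈ I) (hz : z ∈ I) :
    diffQuot I Φ u z = ((slope Φ u z : ℝ) : EReal) := by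
  rw [diffQuot, extendTop, extendTop, if_pos hu, if_pos hz, ← EReal.coe_sub, ← EReal.coe_div,
    slope_def_field]

theorem diffQuot_of_notMem_of_lt (hu : u ∈ I) (hz : z ∉ I) (h : z < u) :
    diffQuot I Φ u z = ⊥ := by
  rw [diffQuot, extendTop, extendTop, if_pos hu, if_neg hz, EReal.top_sub_coe,
    EReal.top_div_of_neg_ne_bot (by exact_mod_cast sub_neg.2 h) (EReal.coe_ne_bot _)]

theorem diffQuot_of_notMem_of_gt (hu : u ∈ I) (hz : z ∉ I) (h : u < z) :
    diffQuot I Φ u z = ⊤ := by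
  rw [diffQuot, extendTop, extendTop, if_pos hu, if_neg hz, EReal.top_sub_coe,
    EReal.top_div_of_pos_ne_top (by exact_mod_cast sub_pos.2 h) (EReal.coe_ne_top _)]

theorem monotoneOn_diffQuot_Iio (hΦ : ConvexOn ℝ I Φ) (hu : u ∈ I) :
    MonotoneOn (diffQuot I Φ u) (Set.Iio u) := by
  intro x hx y hy hxy
  by_cases hxI : x ∈ I
  · have hyI : y ∈ I := hΦ.1.ordConnected.out hxI hu ⟨hxy, (Set.mem_Iio.1 hy).le⟩
    rw [diffQuot_of_mem hu hxI, diffQuot_of_mem hu hyI, EReal.coe_le_coe_iff]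
    exact hΦ.slope_mono hu ⟨hxI, (Set.mem_Iio.1 hx).ne⟩ ⟨hyI, (Set.mem_Iio.1 hy).ne⟩ hxy
  · rw [diffQuot_of_notMem_of_lt hu hxI hx]
    exact bot_le

theorem monotoneOn_diffQuot_Ioi (hΦ : ConvexOn ℝ I Φ) (hu : u ∈ I) :
    MonotoneOn (diffQuot I Φ u) (Set.Ioi u) := by
  intro x hx y hy hxy
  by_cases hyI : y ∈ I
  · have hxI : x ∈ I := hΦ.1.ordConnected.out hu hyI ⟨(Set.mem_Ioi.1 hx).le, hxy⟩
    rw [diffQuot_of_mem hu hxI, diffQuot_of_mem hu hyI, EReal.coe_le_coe_iff]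
    exact hΦ.slope_mono hu ⟨hxI, (Set.mem_Ioi.1 hx).ne'⟩ ⟨hyI, (Set.mem_Ioi.1 hy).ne'⟩ hxy
  · rw [diffQuot_of_notMem_of_gt hu hyI hy]
    exact le_top

/-- The difference quotient is monotone even where it takes the value `⊥` outside `I`, so its
one-sided limit in `EReal` exists and is a supremum. -/
theorem slope_le_leftDerivative (hΦ : ConvexOn ℝ I Φ) (hu : u ∈ I) (hz : z ∈ I) (h : z < u) :
    ((slope Φ u z : ℝ) : EReal) ≤ leftDerivative I Φ u := by
  have hl : leftDerivative I Φ u = sSup (diffQuot I Φ u '' Set.Iio u) :=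
    ((monotoneOn_diffQuot_Iio hΦ hu).tendsto_nhdsLT (OrderTop.bddAbove _)).limUnder_eq
  rw [hl, ← diffQuot_of_mem hu hz]
  exact le_sSup ⟨z, h, rfl⟩

theorem rightDerivative_le_slope (hΦ : ConvexOn ℝ I Φ) (hu : u ∈ I) (hz : z ∈ I) (h : u < z) :
    rightDerivative I Φ u ≤ ((slope Φ u z : ℝ) : EReal) := by
  have hl : rightDerivative I Φ u = sInf (diffQuot I Φ u '' Set.Ioi u) :=
    ((monotoneOn_diffQuot_Ioi hΦ hu).tendsto_nhdsGT (OrderBot.bddBelow _)).limUnder_eq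
  rw [hl, ← diffQuot_of_mem hu hz]
  exact sInf_le ⟨z, h, rfl⟩

theorem bregman_nonneg (hΦ : ConvexOn ℝ I Φ)
    (hφ : ∀ u ∈ I, leftDerivative I Φ u ≤ φ u ∧ φ u ≤ rightDerivative I Φ u)
    (hfin : ∀ u ∈ I, φ u ≠ ⊥ ∧ φ u ≠ ⊤) (hz : z ∈ I) (hu : u ∈ I) :
    0 ≤ bregman Φ φ z u := by
  have hc : (((φ u).toReal : ℝ) : EReal) = φ u :=
    EReal.coe_toReal (hfin u hu).2 (hfin u hu).1
  unfold bregman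
  rcases lt_trichotomy z u with h | rfl | h
  · have h1 := (slope_le_leftDerivative hΦ hu hz h).trans (hφ u hu).1
    rw [← hc, EReal.coe_le_coe_iff, slope_def_field, div_le_iff_of_neg (sub_neg.2 h)] at h1
    linarith
  · simp
  · have h1 := (hφ u hu).2.trans (rightDerivative_le_slope hΦ hu hz h)
    rw [← hc, EReal.coe_le_coe_iff, slope_def_field, le_div_iff₀ (sub_pos.2 h)] at h1
    linarith

theorem monotoneOn_toReal_of_bregman_nonneg
    (h : ∀ z ∈ I, ∀ u ∈ I, 0 ≤ bregman Φ φ z u) :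
    MonotoneOn (fun u => (φ u).toReal) I := by
  intro x hx y hy hxy
  rcases hxy.eq_or_lt with rfl | hlt
  · exact le_rfl
  have h1 := h x hx y hy
  have h2 := h y hy x hx
  unfold bregman at h1 h2
  -- The sum of the two divergences; the `Φ` terms cancel.
  have h3 : 0 ≤ ((φ y).toReal - (φ x).toReal) * (y - x) := by linarith
  exact sub_nonneg.1 (nonneg_of_mul_nonneg_left h3 (sub_pos.2 hlt))

/-- With `m` the midpoint of `z` and `u`, strict convexity gives `Δ(z,u) > 2 Δ(m,u) ≥ 0`. -/
theorem bregman_pos (hΦ : StrictConvexOn ℝ I Φ)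
    (h : ∀ z ∈ I, ∀ u ∈ I, 0 ≤ bregman Φ φ z u) (hz : z ∈ I) (hu : u ∈ I) (hne : z ≠ u) :
    0 < bregman Φ φ z u := by
  have h2 : (0 : ℝ) < 1 / 2 := by norm_num
  have hs : (1 / 2 : ℝ) + 1 / 2 = 1 := by norm_num
  have h1 := hΦ.2 hz hu hne h2 h2 hs
  have h3 := h _ (hΦ.1 hz hu h2.le h2.le hs) u hu
  simp only [smul_eq_mul, bregman] at *
  linarith

end Convex

/-! ### Weighted projection in `L²` and its first-order condition -/

section Weighted

variable {α : Type*} {mα : MeasurableSpace α} {μ : Measure α}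

theorem integrable_mul_weight {F : α → ℝ} (hF : Integrable F μ) (w : Lp ℝ ∞ μ) :
    Integrable (fun x => F x * w x) μ :=
  hF.mul_of_top_left (Lp.memLp w)

/-- Multiplication by `√w` turns the weighted distance into the ordinary norm. The lower bound on
`w` makes it antilipschitz, so the image of `K` is complete and convex and the Hilbert projection
theorem applies. -/
theorem exists_isMinOn_weighted {w : Lp ℝ ∞ μ} {c : ℝ} (hc : 0 < c) (hw : ∀ᵐ x ∂μ, c ≤ w x)
    {K : Set (Lp ℝ 2 μ)} (hK : IsClosed K) (hconv : Convex ℝ K) (hne : K.Nonempty)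
    (f : Lp ℝ 2 μ) :
    ∃ p ∈ K, IsMinOn (fun g : Lp ℝ 2 μ => ∫ x, |f x - g x| ^ 2 * w x ∂μ) K p := by
  have hs : MemLp (fun x => √(w x)) ∞ μ := by
    refine memLp_top_of_bound
      (Real.continuous_sqrt.comp_aestronglyMeasurable (Lp.aestronglyMeasurable w))
      (√(lpNorm w ∞ μ)) ?_
    filter_upwards [ae_le_lpNorm_exponent_top (Lp.memLp w)] with x hx
    rw [Real.norm_of_nonneg (Real.sqrt_nonneg _)]
    exact Real.sqrt_le_sqrt ((Real.le_norm_self _).trans hx)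
  let T : Lp ℝ 2 μ →L[ℝ] Lp ℝ 2 μ :=
    (ContinuousLinearMap.mul ℝ ℝ).holderL μ ∞ 2 2 (hs.toLp _)
  have hT (g : Lp ℝ 2 μ) : T g =ᵐ[μ] fun x => √(w x) * g x := by
    filter_upwards [(ContinuousLinearMap.mul ℝ ℝ).coeFn_holder (r := 2) (hs.toLp _) g,
      hs.coeFn_toLp] with x h1 h2
    change ((ContinuousLinearMap.mul ℝ ℝ).holder 2 (hs.toLp _) g) x = _
    rw [h1, h2]
    rfl
  have hnorm (g : Lp ℝ 2 μ) : ‖T f - T g‖ ^ 2 = ∫ x, |f x - g x| ^ 2 * w x ∂μ := by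
    rw [← map_sub, ← real_inner_self_eq_norm_sq, L2.inner_def]
    refine integral_congr_ae ?_
    filter_upwards [hT (f - g), Lp.coeFn_sub f g, hw] with x h1 h2 h3
    rw [real_inner_self_eq_norm_sq, h1, h2, norm_mul, mul_pow,
      Real.norm_of_nonneg (Real.sqrt_nonneg _), Real.sq_sqrt (hc.le.trans h3)]
    simp [mul_comm]
  have hanti : AntilipschitzWith (Real.toNNReal (√c)⁻¹) T := by
    refine AddMonoidHomClass.antilipschitz_of_bound T fun g => ?_
    refine Lp.norm_le_mul_norm_of_ae_le_mul ?_
    filter_upwards [hT g, hw] with x h1 h3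
    rw [h1, norm_mul, Real.norm_of_nonneg (Real.sqrt_nonneg _),
      Real.coe_toNNReal _ (inv_nonneg.2 (Real.sqrt_nonneg _)), ← mul_assoc]
    refine le_mul_of_one_le_left (norm_nonneg _) ?_
    rw [inv_mul_eq_div, one_le_div (Real.sqrt_pos.2 hc)]
    exact Real.sqrt_le_sqrt h3
  have hcompl : IsComplete (T '' K) :=
    (isComplete_image_iff (hanti.isUniformInducing T.uniformContinuous)).2 hK.isComplete
  obtain ⟨_, ⟨p, hp, rfl⟩, hmin⟩ := exists_norm_eq_iInf_of_complete_convex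
    (hne.image T) hcompl (hconv.linear_image T.toLinearMap) (T f)
  refine ⟨p, hp, fun g hg => ?_⟩
  change (∫ x, |f x - p x| ^ 2 * w x ∂μ) ≤ ∫ x, |f x - g x| ^ 2 * w x ∂μ
  rw [← hnorm, ← hnorm]
  refine pow_le_pow_left₀ (norm_nonneg _) ?_ 2
  rw [hmin]
  exact ciInf_le (f := fun q : T '' K => ‖T f - q‖)
    ⟨0, Set.forall_mem_range.2 fun _ => norm_nonneg _⟩ ⟨T g, Set.mem_image_of_mem _ hg⟩

theorem integral_mul_weight_nonpos_of_forall_le {w : Lp ℝ ∞ μ} {f p h : Lp ℝ 2 μ}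
    (hmin : ∀ t ∈ Set.Ioc (0 : ℝ) 1, ∫ x, |f x - p x| ^ 2 * w x ∂μ ≤
      ∫ x, |f x - (p + t • h : Lp ℝ 2 μ) x| ^ 2 * w x ∂μ) :
    ∫ x, h x * ((f x - p x) * w x) ∂μ ≤ 0 := by
  have hfp : MemLp (fun x => f x - p x) 2 μ := (Lp.memLp f).sub (Lp.memLp p)
  have i1 : Integrable (fun x => |f x - p x| ^ 2 * w x) μ := by
    simpa [sq_abs] using integrable_mul_weight hfp.integrable_sq w
  have i2 : Integrable (fun x => h x * ((f x - p x) * w x)) μ := by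
    simpa [mul_assoc] using integrable_mul_weight ((Lp.memLp h).integrable_mul hfp) w
  have i3 : Integrable (fun x => h x ^ 2 * w x) μ :=
    integrable_mul_weight (Lp.memLp h).integrable_sq w
  set A := ∫ x, h x * ((f x - p x) * w x) ∂μ with hA
  set B := ∫ x, h x ^ 2 * w x ∂μ with hB
  -- Expansion of the square at `p + t h`, divided by `t > 0`; letting `t` tend to `0` leaves `A ≤
  -- 0`.
  have key (t : ℝ) (ht : t ∈ Set.Ioc (0 : ℝ) 1) : 2 * A ≤ t * B := by
    have h1 := hmin t ht
    have h2 : ∫ x, |f x - (p + t • h : Lp ℝ 2 μ) x| ^ 2 * w x ∂μ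
        = ∫ x, |f x - p x| ^ 2 * w x ∂μ - 2 * t * A + t ^ 2 * B := by
      have i12 : Integrable (fun x => |f x - p x| ^ 2 * w x
          - 2 * t * (h x * ((f x - p x) * w x))) μ := i1.sub (i2.const_mul _)
      rw [hA, hB, ← integral_const_mul, ← integral_const_mul, ← integral_sub i1 (i2.const_mul _),
        ← integral_add i12 (i3.const_mul _)]
      refine integral_congr_ae ?_
      filter_upwards [Lp.coeFn_add p (t • h), Lp.coeFn_smul t h] with x e1 e2
      rw [e1, Pi.add_apply, e2, Pi.smul_apply, smul_eq_mul, sq_abs]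
      simp only [sq_abs]
      ring
    rw [h2] at h1
    have h3 : 0 ≤ t * (t * B - 2 * A) := by linarith
    linarith [nonneg_of_mul_nonneg_right h3 ht.1]
  have hlim : Tendsto (fun t : ℝ => t * B) (𝓝[>] 0) (𝓝 0) := by
    have h0 : Continuous fun t : ℝ => t * B := by fun_prop
    exact (h0.tendsto' 0 0 (zero_mul B)).mono_left nhdsWithin_le_nhds
  have := ge_of_tendsto hlim (by
    filter_upwards [Ioc_mem_nhdsGT (zero_lt_one' ℝ)] with t ht using key t ht)
  linarith

end Weighted

/-! ### Functions with zero integral over the fibres of `p` -/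

section Fibers

variable {α : Type*} {mα : MeasurableSpace α} {μ : Measure α} {F p : α → ℝ}

theorem setIntegral_preimage_eq_zero (hp : Measurable p) (hF : Integrable F μ)
    (h : ∀ ψ : ℝ → ℝ, LipschitzWith 1 ψ → (∀ u, |ψ u| ≤ 1) → ∫ x, ψ (p x) * F x ∂μ = 0)
    (h1 : ∫ x, F x ∂μ = 0) {A : Set ℝ} (hA : MeasurableSet A) :
    ∫ x in p ⁻¹' A, F x ∂μ = 0 := by
  induction A, hA using MeasurableSpace.induction_on_inter
    (borel_eq_generateFrom_Ioi ℝ ▸ BorelSpace.measurable_eq) isPiSystem_Ioi with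
  | empty => simp
  | basic t ht =>
    obtain ⟨c, rfl⟩ := ht
    -- A ramp truncated at height `1/(n+1)` stays 1-Lipschitz and bounded by 1; multiplied by `n +
    -- 1` it converges to the indicator of `Ioi c`.
    let ψ (n : ℕ) (u : ℝ) : ℝ := min (1 / ((n : ℝ) + 1)) (max 0 (u - c))
    have hn (n : ℕ) : (0 : ℝ) < n + 1 := by positivity
    have hψ0 (n : ℕ) (u : ℝ) : 0 ≤ ψ n u := le_min (by positivity) (le_max_left _ _)
    have hψ1 (n : ℕ) (u : ℝ) : (n + 1) * ψ n u ≤ 1 := by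
      calc (n + 1) * ψ n u ≤ (n + 1) * (1 / ((n : ℝ) + 1)) :=
            mul_le_mul_of_nonneg_left (min_le_left _ _) (hn n).le
        _ = 1 := mul_one_div_cancel (hn n).ne'
    have hlip (n : ℕ) : LipschitzWith 1 (ψ n) := by
      refine LipschitzWith.const_min (LipschitzWith.const_max ?_ _) _
      refine LipschitzWith.of_dist_le_mul fun x y => ?_
      simp [Real.dist_eq]
    have hint (n : ℕ) : ∫ x, ((n + 1) * ψ n (p x)) * F x ∂μ = 0 := by
      have := h (ψ n) (hlip n) fun u => by
        rw [abs_of_nonneg (hψ0 n u)]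
        refine le_trans ?_ (hψ1 n u)
        exact le_mul_of_one_le_left (hψ0 n u) (by linarith [(Nat.cast_nonneg n : (0 : ℝ) ≤ n)])
      simp_rw [mul_assoc]
      rw [integral_const_mul, this, mul_zero]
    have hlim : Tendsto (fun n : ℕ => ∫ x, ((n + 1) * ψ n (p x)) * F x ∂μ) atTop
        (𝓝 (∫ x, (p ⁻¹' Set.Ioi c).indicator F x ∂μ)) := by
      refine tendsto_integral_of_dominated_convergence (fun x => |F x|) (fun n => ?_) hF.abs
        (fun n => ?_) ?_
      · exact (((hlip n).continuous.measurable.comp hp).const_mul _).aestronglyMeasurable.mul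
          hF.aestronglyMeasurable
      · refine Eventually.of_forall fun x => ?_
        rw [norm_mul, Real.norm_eq_abs, Real.norm_eq_abs,
          abs_of_nonneg (mul_nonneg (hn n).le (hψ0 n _))]
        exact mul_le_of_le_one_left (abs_nonneg _) (hψ1 n _)
      · refine Eventually.of_forall fun x => ?_
        by_cases hx : c < p x
        · rw [Set.indicator_of_mem (by exact hx)]
          refine tendsto_const_nhds.congr' ?_
          have ht : Tendsto (fun n : ℕ => 1 / ((n : ℝ) + 1)) atTop (𝓝 0) :=
            tendsto_one_div_add_atTop_nhds_zero_nat
          filter_upwards [ht.eventually_le_const (sub_pos.2 hx)] with n hnx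
          have : ψ n (p x) = 1 / ((n : ℝ) + 1) := min_eq_left (hnx.trans (le_max_right _ _))
          rw [this, mul_one_div_cancel (hn n).ne', one_mul]
        · rw [Set.indicator_of_notMem (by exact hx)]
          refine tendsto_const_nhds.congr fun n => ?_
          have : ψ n (p x) = 0 := by
            change min _ (max 0 (p x - c)) = 0
            rw [max_eq_left (by linarith), min_eq_right (by positivity)]
          rw [this, mul_zero, zero_mul]
    rw [← integral_indicator (hp measurableSet_Ioi)]
    refine tendsto_nhds_unique hlim ?_
    simp_rw [hint]
    exact tendsto_const_nhds
  | compl t ht ih =>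
    rw [Set.preimage_compl, setIntegral_compl (hp ht) hF, ih, h1, sub_zero]
  | iUnion s hd hs ih =>
    rw [Set.preimage_iUnion, integral_iUnion (fun i => hp (hs i))
      (fun i j hij => (hd hij).preimage p) hF.integrableOn]
    simp [ih]

/-- The hypothesis says that the conditional expectation of `F` given `p` is zero, and `ψ ∘ p` can
be pulled out of it. -/
theorem integral_comp_mul_eq_zero [IsFiniteMeasure μ] (hp : Measurable p) (hF : Integrable F μ)
    (h : ∀ A : Set ℝ, MeasurableSet A → ∫ x in p ⁻¹' A, F x ∂μ = 0)
    {ψ : ℝ → ℝ} (hψ : Measurable ψ) (hi : Integrable (fun x => ψ (p x) * F x) μ) :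
    ∫ x, ψ (p x) * F x ∂μ = 0 := by
  have hm := hp.comap_le
  have hce : (0 : α → ℝ) =ᵐ[μ] μ[F | MeasurableSpace.comap p inferInstance] := by
    refine ae_eq_condExp_of_forall_setIntegral_eq hm hF (fun s _ _ => integrableOn_zero) ?_
      aestronglyMeasurable_zero
    rintro _ ⟨A, hA, rfl⟩ -
    simp [h A hA]
  have hmul := condExp_mul_of_stronglyMeasurable_left
    (m := MeasurableSpace.comap p inferInstance) (f := fun x => ψ (p x))
    (hψ.comp (comap_measurable p)).stronglyMeasurable hi hF
  rw [← integral_condExp hm]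
  refine integral_eq_zero_of_ae ?_
  filter_upwards [hmul, hce] with x h1 h2
  refine h1.trans ?_
  rw [Pi.mul_apply, ← h2, Pi.zero_apply, mul_zero]

theorem measure_eq_zero_of_setIntegral_eq_zero (hF : Integrable F μ) {S : Set α}
    (hS : MeasurableSet S) (hpos : ∀ᵐ x ∂μ, x ∈ S → 0 < F x) (h : ∫ x in S, F x ∂μ = 0) :
    ∀ᵐ x ∂μ, x ∉ S := by
  have hpos' : ∀ᵐ x ∂μ.restrict S, 0 < F x := (ae_restrict_iff' hS).2 hpos
  have h0 := (integral_eq_zero_iff_of_nonneg_ae (hpos'.mono fun x hx => hx.le)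
    hF.integrableOn).1 h
  have : ∀ᵐ x ∂μ, x ∈ S → F x = 0 := (ae_restrict_iff' hS).1 h0
  filter_upwards [this, hpos] with x h1 h2 hx
  exact (h2 hx).ne' (h1 hx)

/-- Where `p` lies below all of `I`, the residual is strictly positive yet has integral zero, so
this set is null; likewise above `I`. -/
theorem ae_mem_of_setIntegral_preimage_eq_zero {I : Set ℝ} (hI : I.OrdConnected)
    {f w : α → ℝ} (hp : Measurable p) (hF : Integrable (fun x => (f x - p x) * w x) μ)
    (hw : ∀ᵐ x ∂μ, 0 < w x) (hf : ∀ᵐ x ∂μ, f x ∈ I)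
    (h : ∀ A : Set ℝ, MeasurableSet A → ∫ x in p ⁻¹' A, (f x - p x) * w x ∂μ = 0) :
    ∀ᵐ x ∂μ, p x ∈ I := by
  have m1 : MeasurableSet {u : ℝ | ∀ v ∈ I, u < v} :=
    Set.OrdConnected.measurableSet
      ⟨fun x _ y hy z hz v hv => hz.2.trans_lt (hy v hv)⟩
  have m2 : MeasurableSet {u : ℝ | ∀ v ∈ I, v < u} :=
    Set.OrdConnected.measurableSet
      ⟨fun x hx y _ z hz v hv => (hx v hv).trans_le hz.1⟩
  have h1 := measure_eq_zero_of_setIntegral_eq_zero hF (hp m1) (by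
    filter_upwards [hw, hf] with x hwx hfx hx
    exact mul_pos (sub_pos.2 (hx _ hfx)) hwx) (h _ m1)
  have h2 := measure_eq_zero_of_setIntegral_eq_zero hF.neg (hp m2) (by
    filter_upwards [hw, hf] with x hwx hfx hx
    exact neg_pos.2 (mul_neg_of_neg_of_pos (sub_neg.2 (hx _ hfx)) hwx)) (by
    simp only [Pi.neg_apply, integral_neg, h _ m2, neg_zero])
  filter_upwards [h1, h2] with x hx1 hx2
  simp only [Set.mem_preimage, Set.mem_ofPred_eq, not_forall, not_lt] at hx1 hx2
  obtain ⟨v, hv, hv1⟩ := hx1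
  obtain ⟨v', hv', hv2⟩ := hx2
  exact hI.out hv hv' ⟨hv1, hv2⟩

end Fibers

variable {d : ℕ} {a b : Fin d → ℝ} {σ : Fin d → SignType} {I : Set ℝ}

instance isFiniteMeasure_boxMeasure : IsFiniteMeasure (boxMeasure a b) :=
  isFiniteMeasure_restrict.2 isCompact_Icc.measure_ne_top

theorem boxMeasure_ne_zero (hab : ∀ i, a i < b i) : boxMeasure a b ≠ 0 := by
  rw [ne_eq, Measure.restrict_eq_zero, Real.volume_Icc_pi, Finset.prod_eq_zero_iff]
  simpa using hab

/-! ### The closed convex cone of monotonic functions -/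

section Cone

theorem essSigMonotone_iff {f : (Fin d → ℝ) → ℝ} :
    EssSigMonotone a b σ f ↔ ∃ P : (Fin d → ℝ) → Prop, (∀ᵐ x ∂boxMeasure a b, P x) ∧
      SigMonotoneOn σ f {x | x ∈ Set.Icc a b ∧ P x} := by
  constructor
  · rintro ⟨N, hN, hf⟩
    exact ⟨fun x => x ∉ N, measure_eq_zero_iff_ae_notMem.1 hN, hf⟩
  · rintro ⟨P, hP, hf⟩
    refine ⟨{x | ¬ P x}, ae_iff.1 hP, fun x hx y hy hxy => ?_⟩
    exact hf x ⟨hx.1, not_not.1 hx.2⟩ y ⟨hy.1, not_not.1 hy.2⟩ hxy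

theorem mem_L2Sig_univ {g : Lp ℝ 2 (boxMeasure a b)} :
    g ∈ L2Sig a b σ Set.univ ↔ EssSigMonotone a b σ g := by
  simp [L2Sig]

theorem mem_L2Sig_univ_of_comp {g h : Lp ℝ 2 (boxMeasure a b)} (hg : g ∈ L2Sig a b σ I)
    {ψ : ℝ → ℝ} (hψ : MonotoneOn ψ I) (hh : h =ᵐ[boxMeasure a b] fun x => ψ (g x)) :
    h ∈ L2Sig a b σ Set.univ := by
  obtain ⟨P, hP, hm⟩ := essSigMonotone_iff.1 hg.1
  refine mem_L2Sig_univ.2 (essSigMonotone_iff.2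
    ⟨_, hP.and (hg.2.and hh), fun x hx y hy hxy => ?_⟩)
  obtain ⟨hx1, hx2, hx3, hx4⟩ := hx
  obtain ⟨hy1, hy2, hy3, hy4⟩ := hy
  rw [hx4, hy4]
  exact hψ hx3 hy3 (hm x ⟨hx1, hx2⟩ y ⟨hy1, hy2⟩ hxy)

theorem smul_add_smul_mem_L2Sig {g h : Lp ℝ 2 (boxMeasure a b)}
    (hg : g ∈ L2Sig a b σ Set.univ) (hh : h ∈ L2Sig a b σ Set.univ) {s t : ℝ} (hs : 0 ≤ s)
    (ht : 0 ≤ t) : s • g + t • h ∈ L2Sig a b σ Set.univ := by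
  obtain ⟨P, hP, hgm⟩ := essSigMonotone_iff.1 hg.1
  obtain ⟨P', hP', hhm⟩ := essSigMonotone_iff.1 hh.1
  have he : ∀ᵐ x ∂boxMeasure a b, (s • g + t • h : Lp ℝ 2 (boxMeasure a b)) x
      = s * g x + t * h x := by
    filter_upwards [Lp.coeFn_add (s • g) (t • h), Lp.coeFn_smul s g, Lp.coeFn_smul t h]
      with x e1 e2 e3
    rw [e1, Pi.add_apply, e2, e3]
    rfl
  refine mem_L2Sig_univ.2 (essSigMonotone_iff.2
    ⟨_, hP.and (hP'.and he), fun x hx y hy hxy => ?_⟩)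
  obtain ⟨hx1, hx2, hx3, hx4⟩ := hx
  obtain ⟨hy1, hy2, hy3, hy4⟩ := hy
  rw [hx4, hy4]
  exact add_le_add
    (mul_le_mul_of_nonneg_left (hgm x ⟨hx1, hx2⟩ y ⟨hy1, hy2⟩ hxy) hs)
    (mul_le_mul_of_nonneg_left (hhm x ⟨hx1, hx3⟩ y ⟨hy1, hy3⟩ hxy) ht)

theorem convex_L2Sig_univ : Convex ℝ (L2Sig a b σ Set.univ) :=
  fun _ hg _ hh _ _ hs ht _ => smul_add_smul_mem_L2Sig hg hh hs ht

/-- A subsequence converges almost everywhere, and the countably many exceptional null sets can be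
discarded together. -/
theorem isClosed_L2Sig_univ : IsClosed (L2Sig a b σ Set.univ) := by
  refine IsSeqClosed.isClosed fun u g hu hlim => ?_
  obtain ⟨ns, -, hns⟩ := (tendstoInMeasure_of_tendsto_Lp hlim).exists_seq_tendsto_ae
  choose P hP hm using fun n => essSigMonotone_iff.1 (hu n).1
  refine mem_L2Sig_univ.2 (essSigMonotone_iff.2
    ⟨_, (ae_all_iff.2 hP).and hns, fun x hx y hy hxy => ?_⟩)
  exact le_of_tendsto_of_tendsto' hx.2.2 hy.2.2 fun n =>
    hm _ x ⟨hx.1, hx.2.1 _⟩ y ⟨hy.1, hy.2.1 _⟩ hxy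

theorem const_mem_L2Sig {u : ℝ} (hu : u ∈ I) {g : Lp ℝ 2 (boxMeasure a b)}
    (hg : g =ᵐ[boxMeasure a b] fun _ => u) : g ∈ L2Sig a b σ I := by
  refine ⟨essSigMonotone_iff.2 ⟨_, hg, fun x hx y hy _ => ?_⟩, hg.mono fun x hx => ?_⟩
  · rw [hx.2, hy.2]
  · rwa [hx]

end Cone

/-- A weight within `c / 2` in sup norm of a function bounded below by `c` is at least `c / 2`. -/
theorem exists_pos_le_of_mem_posWeights {w : Lp ℝ ∞ (boxMeasure a b)} (hw : w ∈ posWeights a b) :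
    ∃ c : ℝ, 0 < c ∧ ∀ᵐ x ∂boxMeasure a b, c ≤ w x := by
  simp only [posWeights, Set.mem_iUnion] at hw
  obtain ⟨c, hc, hw⟩ := hw
  have hc' : 0 < c / 2 := half_pos hc
  obtain ⟨h, ⟨s, -, hs, hhs⟩, hd⟩ := Metric.mem_closure_iff.1 hw (c / 2) hc'
  refine ⟨c / 2, hc', ?_⟩
  have hb := ae_le_lpNorm_exponent_top (Lp.memLp (w - h))
  have hn : lpNorm (w - h : Lp ℝ ∞ (boxMeasure a b)) ∞ (boxMeasure a b) < c / 2 := by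
    rwa [← toReal_eLpNorm (Lp.aestronglyMeasurable _), ← Lp.norm_def, ← dist_eq_norm]
  filter_upwards [hb, hhs, Lp.coeFn_sub w h, ae_restrict_mem measurableSet_Icc] with x h1 h2 h3 h4
  rw [h3, Pi.sub_apply, h2, Real.norm_eq_abs] at h1
  have h5 : c ≤ s x := hs x h4
  linarith [neg_abs_le (w x - s x)]

theorem isRegression_regression {w : Lp ℝ ∞ (boxMeasure a b)} (hw : w ∈ posWeights a b)
    (f : Lp ℝ 2 (boxMeasure a b)) : IsRegression σ w f (regression σ w f) := by
  obtain ⟨c, hc, hwc⟩ := exists_pos_le_of_mem_posWeights hw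
  obtain ⟨p, hp, hmin⟩ := exists_isMinOn_weighted hc hwc (isClosed_L2Sig_univ (σ := σ))
    convex_L2Sig_univ ⟨0, const_mem_L2Sig (Set.mem_univ 0) (Lp.coeFn_zero _ _ _)⟩ f
  exact Classical.epsilon_spec (p := IsRegression σ w f) ⟨p, hp, hmin⟩

/-! ### Orthogonality of the residual to functions of the regression -/

namespace IsRegression

variable {w : Lp ℝ ∞ (boxMeasure a b)} {f p : Lp ℝ 2 (boxMeasure a b)}

theorem integrable_residual (w : Lp ℝ ∞ (boxMeasure a b)) (f p : Lp ℝ 2 (boxMeasure a b)) :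
    Integrable (fun x => (f x - p x) * w x) (boxMeasure a b) :=
  integrable_mul_weight (((Lp.memLp f).sub (Lp.memLp p)).integrable one_le_two) w

theorem integrable_mul_residual (w : Lp ℝ ∞ (boxMeasure a b)) (f p : Lp ℝ 2 (boxMeasure a b))
    {h : (Fin d → ℝ) → ℝ} (hh : MemLp h 2 (boxMeasure a b)) :
    Integrable (fun x => h x * ((f x - p x) * w x)) (boxMeasure a b) := by
  simpa [mul_assoc] using
    integrable_mul_weight (hh.integrable_mul ((Lp.memLp f).sub (Lp.memLp p))) w

theorem integral_mul_residual_nonpos (hp : IsRegression σ w f p) {h : Lp ℝ 2 (boxMeasure a b)}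
    (hh : h ∈ L2Sig a b σ Set.univ) :
    ∫ x, h x * ((f x - p x) * w x) ∂boxMeasure a b ≤ 0 :=
  integral_mul_weight_nonpos_of_forall_le fun t ht => hp.2 (by
    simpa using smul_add_smul_mem_L2Sig hp.1 hh zero_le_one ht.1.le)

theorem memLp_comp_bounded (p : Lp ℝ 2 (boxMeasure a b)) {ψ : ℝ → ℝ} (hψ : Measurable ψ)
    (hb : ∀ u, |ψ u| ≤ 1) : MemLp (fun x => ψ (p x)) 2 (boxMeasure a b) :=
  MemLp.of_bound (hψ.comp_aemeasurable (Lp.aestronglyMeasurable p).aemeasurable).aestronglyMeasurable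
    1 (Eventually.of_forall fun _ => hb _)

theorem integral_lipschitz_mul_residual_nonpos (hp : IsRegression σ w f p) {ψ : ℝ → ℝ}
    (hψ : LipschitzWith 1 ψ) (hb : ∀ u, |ψ u| ≤ 1) :
    ∫ x, ψ (p x) * ((f x - p x) * w x) ∂boxMeasure a b ≤ 0 := by
  have hm := memLp_comp_bounded p hψ.continuous.measurable hb
  have hle := integral_mul_weight_nonpos_of_forall_le (h := hm.toLp _) (w := w) (f := f) (p := p)
    fun t ht => hp.2 (mem_L2Sig_univ_of_comp (I := Set.univ) hp.1 (ψ := fun u => u + t * ψ u) ?_ ?_)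
  · refine le_of_eq_of_le (integral_congr_ae ?_) hle
    filter_upwards [hm.coeFn_toLp] with x hx
    rw [hx]
  -- Since `t ≤ 1` and `ψ` is 1-Lipschitz, `t * ψ` cannot decrease faster than `u` increases.
  · intro u _ v _ huv
    have h1 := hψ.dist_le_mul u v
    rw [NNReal.coe_one, one_mul, Real.dist_eq, Real.dist_eq, abs_of_nonpos (sub_nonpos.2 huv)] at h1
    have h2 : t * (ψ u - ψ v) ≤ 1 * (v - u) := by
      refine (mul_le_mul_of_nonneg_left ((le_abs_self _).trans h1) ht.1.le).trans ?_
      exact (mul_le_mul_of_nonneg_right ht.2 (by linarith)).trans_eq' (by ring)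
    change u + t * ψ u ≤ v + t * ψ v
    linarith
  · filter_upwards [hm.coeFn_toLp, Lp.coeFn_add p (t • hm.toLp _), Lp.coeFn_smul t (hm.toLp _)]
      with x h1 h2 h3
    rw [h2, Pi.add_apply, h3, Pi.smul_apply, h1, smul_eq_mul]

theorem integral_lipschitz_mul_residual (hp : IsRegression σ w f p) {ψ : ℝ → ℝ}
    (hψ : LipschitzWith 1 ψ) (hb : ∀ u, |ψ u| ≤ 1) :
    ∫ x, ψ (p x) * ((f x - p x) * w x) ∂boxMeasure a b = 0 := by
  refine le_antisymm (hp.integral_lipschitz_mul_residual_nonpos hψ hb) ?_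
  have := hp.integral_lipschitz_mul_residual_nonpos (ψ := fun u => -ψ u) hψ.neg
    fun u => by simpa using hb u
  simpa [integral_neg] using this

theorem setIntegral_preimage_residual (hp : IsRegression σ w f p) {A : Set ℝ}
    (hA : MeasurableSet A) :
    ∫ x in p ⁻¹' A, (f x - p x) * w x ∂boxMeasure a b = 0 :=
  setIntegral_preimage_eq_zero (Lp.stronglyMeasurable p).measurable (integrable_residual w f p)
    (fun _ hψ hb => hp.integral_lipschitz_mul_residual hψ hb)
    (by simpa using hp.integral_lipschitz_mul_residual (ψ := fun _ => 1)
          (LipschitzWith.const' 1) (by simp)) hA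

theorem mem_L2Sig (hp : IsRegression σ w f p) (hw : ∀ᵐ x ∂boxMeasure a b, 0 < w x)
    (hI : I.OrdConnected) (hf : ∀ᵐ x ∂boxMeasure a b, f x ∈ I) : p ∈ L2Sig a b σ I :=
  ⟨hp.1.1, ae_mem_of_setIntegral_preimage_eq_zero hI (Lp.stronglyMeasurable p).measurable
    (integrable_residual w f p) hw hf fun _ hA => hp.setIntegral_preimage_residual hA⟩

theorem integral_monotoneOn_mul_residual (hp : IsRegression σ w f p) (hI : I.OrdConnected)
    (hpI : ∀ᵐ x ∂boxMeasure a b, p x ∈ I) {ψ : ℝ → ℝ} (hψ : MonotoneOn ψ I)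
    (hm : MemLp (fun x => ψ (p x)) 2 (boxMeasure a b)) :
    ∫ x, ψ (p x) * ((f x - p x) * w x) ∂boxMeasure a b = 0 := by
  -- Nothing is known about `ψ` off `I`; extension by zero makes it Borel and changes the integrand
  -- only on a null set.
  have hmeas : Measurable (I.indicator ψ) := by
    refine measurable_of_restrict_of_restrict_compl hI.measurableSet ?_ ?_
    · have : I.domRestrict (I.indicator ψ) = fun x : I => ψ x :=
        funext fun x => Set.indicator_of_mem x.2 ψ
      rw [this]
      exact Monotone.measurable fun x y hxy => hψ x.2 y.2 hxy
    · have : Iᶜ.domRestrict (I.indicator ψ) = fun _ => 0 :=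
        funext fun x => Set.indicator_of_notMem x.2 ψ
      rw [this]
      exact measurable_const
  have hae : (fun x => ψ (p x) * ((f x - p x) * w x)) =ᵐ[boxMeasure a b]
      fun x => I.indicator ψ (p x) * ((f x - p x) * w x) := by
    filter_upwards [hpI] with x hx
    rw [Set.indicator_of_mem hx]
  rw [integral_congr_ae hae]
  exact integral_comp_mul_eq_zero (Lp.stronglyMeasurable p).measurable (integrable_residual w f p)
    (fun _ hA => hp.setIntegral_preimage_residual hA) hmeas
    ((integrable_mul_residual w f p hm).congr hae)

end IsRegression

/-! ### The Bregman functional -/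

theorem ne_bot_and_ne_top_of_forall_extMemL2 (hab : ∀ i, a i < b i) {φ : ℝ → EReal}
    (hφg : ∀ g ∈ L2Sig a b σ I, ExtMemL2 a b (fun x => φ (g x))) {u : ℝ} (hu : u ∈ I) :
    φ u ≠ ⊥ ∧ φ u ≠ ⊤ := by
  have hc := (memLp_const (p := 2) (μ := boxMeasure a b) u).coeFn_toLp
  have : NeZero (boxMeasure a b) := ⟨boxMeasure_ne_zero hab⟩
  obtain ⟨x, hx, h⟩ := (hc.and (hφg _ (const_mem_L2Sig hu hc)).1).exists
  simpa only [hx] using h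

theorem integrable_bregman_mul {Φ : ℝ → ℝ} {φ : ℝ → EReal} (w : Lp ℝ ∞ (boxMeasure a b))
    {f g : Lp ℝ 2 (boxMeasure a b)} (hf : Integrable (fun x => Φ (f x)) (boxMeasure a b))
    (hg : Integrable (fun x => Φ (g x)) (boxMeasure a b))
    (hφ : ExtMemL2 a b (fun x => φ (g x))) :
    Integrable (fun x => bregman Φ φ (f x) (g x) * w x) (boxMeasure a b) :=
  integrable_mul_weight
    ((hf.sub hg).sub (hφ.2.integrable_mul ((Lp.memLp f).sub (Lp.memLp g)))) w

/-- The Pythagorean inequality for the Bregman divergence. -/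
theorem IsRegression.integral_bregman_add_le {w : Lp ℝ ∞ (boxMeasure a b)}
    {f p g : Lp ℝ 2 (boxMeasure a b)} (hp : IsRegression σ w f p) (hpI : p ∈ L2Sig a b σ I)
    (hI : I.OrdConnected) {Φ : ℝ → ℝ} {φ : ℝ → EReal}
    (hmono : MonotoneOn (fun u => (φ u).toReal) I)
    (hΦf : Integrable (fun x => Φ (f x)) (boxMeasure a b))
    (hΦg : ∀ g ∈ L2Sig a b σ I, Integrable (fun x => Φ (g x)) (boxMeasure a b))
    (hφg : ∀ g ∈ L2Sig a b σ I, ExtMemL2 a b (fun x => φ (g x))) (hg : g ∈ L2Sig a b σ I) :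
    ∫ x, bregman Φ φ (p x) (g x) * w x ∂boxMeasure a b + bregmanFunctional Φ φ w f p ≤
      bregmanFunctional Φ φ w f g := by
  have hmg := (hφg g hg).2
  have hmp := (hφg p hpI).2
  have i1 := integrable_bregman_mul w (hΦg p hpI) (hΦg g hg) (hφg g hg)
  have i2 := integrable_bregman_mul w hΦf (hΦg p hpI) (hφg p hpI)
  have i3 := IsRegression.integrable_mul_residual w f p hmp
  have i4 := IsRegression.integrable_mul_residual w f p hmg
  have h3 := hp.integral_monotoneOn_mul_residual hI hpI.2 hmono hmp
  have h4 : ∫ x, (φ (g x)).toReal * ((f x - p x) * w x) ∂boxMeasure a b ≤ 0 := by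
    refine le_of_eq_of_le (integral_congr_ae ?_) (hp.integral_mul_residual_nonpos
      (mem_L2Sig_univ_of_comp hg hmono hmg.coeFn_toLp))
    filter_upwards [hmg.coeFn_toLp] with x hx
    rw [hx]
  have i12 : Integrable (fun x => bregman Φ φ (p x) (g x) * w x
      + bregman Φ φ (f x) (p x) * w x) (boxMeasure a b) := i1.add i2
  have i34 : Integrable (fun x => (φ (p x)).toReal * ((f x - p x) * w x)
      - (φ (g x)).toReal * ((f x - p x) * w x)) (boxMeasure a b) := i3.sub i4
  -- The three-point identity, integrated against `w`.
  have key : bregmanFunctional Φ φ w f g =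
      ∫ x, bregman Φ φ (p x) (g x) * w x ∂boxMeasure a b + bregmanFunctional Φ φ w f p
        + (∫ x, (φ (p x)).toReal * ((f x - p x) * w x) ∂boxMeasure a b
          - ∫ x, (φ (g x)).toReal * ((f x - p x) * w x) ∂boxMeasure a b) := by
    unfold bregmanFunctional
    rw [← integral_add i1 i2, ← integral_sub i3 i4, ← integral_add i12 i34]
    refine integral_congr_ae (Eventually.of_forall fun x => ?_)
    simp only [bregman]
    ring
  rw [key, h3]
  linarith

end MonotonicRegression
end

theorem theorem5p4 {d : ℕ} (a b : Fin d → ℝ) (hab : ∀ i, a i < b i) (σ : Fin d → SignType)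
    (f : Lp ℝ 2 (MonotonicRegression.boxMeasure a b))
    (w : Lp ℝ ∞ (MonotonicRegression.boxMeasure a b))
    (hw : w ∈ MonotonicRegression.posWeights a b)
    (I : Set ℝ) (Φ : ℝ → ℝ) (hΦ : ConvexOn ℝ I Φ) (φ : ℝ → EReal)
    (hφ : ∀ u ∈ I, MonotonicRegression.leftDerivative I Φ u ≤ φ u ∧
      φ u ≤ MonotonicRegression.rightDerivative I Φ u)
    (hfI : ∃ f₀ : (Fin d → ℝ) → ℝ, f =ᵐ[MonotonicRegression.boxMeasure a b] f₀ ∧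
      f₀ '' Set.Icc a b ⊆ I)
    (hΦf : Integrable (fun x => Φ (f x)) (MonotonicRegression.boxMeasure a b))
    (hΦg : ∀ g ∈ MonotonicRegression.L2Sig a b σ I,
      Integrable (fun x => Φ (g x)) (MonotonicRegression.boxMeasure a b))
    (hφg : ∀ g ∈ MonotonicRegression.L2Sig a b σ I,
      MonotonicRegression.ExtMemL2 a b (fun x => φ (g x))) :
    (∀ g ∈ MonotonicRegression.L2Sig a b σ I,
      Integrable (fun x => MonotonicRegression.bregman Φ φ (f x) (g x) * w x)
        (MonotonicRegression.boxMeasure a b)) ∧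
    MonotonicRegression.regression σ w f ∈ MonotonicRegression.L2Sig a b σ I ∧
    IsMinOn (MonotonicRegression.bregmanFunctional Φ φ w f) (MonotonicRegression.L2Sig a b σ I)
      (MonotonicRegression.regression σ w f) ∧
    (StrictConvexOn ℝ I Φ → ∀ g ∈ MonotonicRegression.L2Sig a b σ I,
      IsMinOn (MonotonicRegression.bregmanFunctional Φ φ w f)
        (MonotonicRegression.L2Sig a b σ I) g →
      g = MonotonicRegression.regression σ w f) := by
  open MonotonicRegression in
  have hI : I.OrdConnected := hΦ.1.ordConnected
  have hp := isRegression_regression (σ := σ) hw f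
  set p := regression σ w f
  have hw0 : ∀ᵐ x ∂boxMeasure a b, 0 < w x := by
    obtain ⟨c, hc, hwc⟩ := exists_pos_le_of_mem_posWeights hw
    exact hwc.mono fun x hx => hc.trans_le hx
  have hfI' : ∀ᵐ x ∂boxMeasure a b, f x ∈ I := by
    obtain ⟨f₀, hff, hf₀⟩ := hfI
    filter_upwards [hff, ae_restrict_mem measurableSet_Icc] with x hx hxQ
    rw [hx]
    exact hf₀ ⟨x, hxQ, rfl⟩
  have hpI : p ∈ L2Sig a b σ I := hp.mem_L2Sig hw0 hI hfI'
  have hB : ∀ z ∈ I, ∀ u ∈ I, 0 ≤ bregman Φ φ z u := fun z hz u hu =>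
    bregman_nonneg hΦ hφ (fun v hv => ne_bot_and_ne_top_of_forall_extMemL2 hab hφg hv) hz hu
  have hpyth {g : Lp ℝ 2 (boxMeasure a b)} (hg : g ∈ L2Sig a b σ I) :=
    hp.integral_bregman_add_le hpI hI (monotoneOn_toReal_of_bregman_nonneg hB) hΦf hΦg hφg hg
  have hnn {g : Lp ℝ 2 (boxMeasure a b)} (hg : g ∈ L2Sig a b σ I) :
      0 ≤ᵐ[boxMeasure a b] fun x => bregman Φ φ (p x) (g x) * w x := by
    filter_upwards [hpI.2, hg.2, hw0] with x h1 h2 h3 using mul_nonneg (hB _ h1 _ h2) h3.le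
  refine ⟨fun g hg => integrable_bregman_mul w hΦf (hΦg g hg) (hφg g hg), hpI, fun g hg => ?_,
    fun hs g hg hmin => ?_⟩
  · exact (le_add_of_nonneg_left (integral_nonneg_of_ae (hnn hg))).trans (hpyth hg)
  · have h1 : bregmanFunctional Φ φ w f g ≤ bregmanFunctional Φ φ w f p := hmin hpI
    -- Equal values of the functional leave no room in the Pythagorean inequality, so the divergence
    -- of `p` from `g` vanishes almost everywhere.
    have h2 : ∫ x, bregman Φ φ (p x) (g x) * w x ∂boxMeasure a b = 0 :=
      le_antisymm (by linarith [hpyth hg]) (integral_nonneg_of_ae (hnn hg))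
    have h3 := (integral_eq_zero_iff_of_nonneg_ae (hnn hg)
      (integrable_bregman_mul w (hΦg p hpI) (hΦg g hg) (hφg g hg))).1 h2
    refine Lp.ext ?_
    filter_upwards [h3, hpI.2, hg.2, hw0] with x h4 h5 h6 h7
    by_contra hne
    exact (mul_pos (bregman_pos hs hB h5 h6 (Ne.symm hne)) h7).ne' h4
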